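/- Theorem 6. Consider the single-user multiple-request caching problem. There are $N$ files $W_1,\dots,W_N$, independent and uniformly distributed on $[2^F]$, and the user may request any subset $y\subseteq[N]$ of them. For $M\ge 0$ and $\mathbf R=(R_y)_{y\subseteq[N]}$ with all $R_y\ge 0$, an $(M,\mathbf R)$ caching scheme with file size $F\ge1$ consists of a cache encoder $z:[2^F]^N\to[2^{\lfloor FM\rfloor}]$, update encoders $x_y:[2^F]^N\to[2^{\lfloor FR_y\rfloor}]$, and decoders that map $(z,x_y,y)$ to estimates $(\hat w_n)_{n\in y}\in[2^F]^{y}$, one of each for every $y\subseteq[N]$ (the cache encoder does not depend on $y$). Its probability of error is $\max_{y\subseteq[N]}\mathbb P(\hat W_n\ne W_n\text{ for some }n\in y)$. The tuple $(M,\mathbf R)$ is achievable if for every $\epsilon>0$ there are $(M,\mathbf R)$ schemes with arbitrarily large file size $F$ and probability of error less than $\epsilon$; $\mathcal R^\star$ is the closure of the set of achievable tuples. Let $p_Y$ be a probability distribution on the subsets of $[N]$ and $$R^\star_{\mathsf{avg}}(M)=\min_{\mathbf R:(M,\mathbf R)\in\mathcal R^\star}\ \sum_{y\subseteq[N]}p_Y(y)R_y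 .$$ Let $s_n=\sum_{y\ni n}p_Y(y)$ be the probability that file $n$ is requested, where the files are numbered so that $s_1\ge s_2\ge\dots\ge s_N$, and let $s_{N+1}=0$. Then for every $M\ge0$ the minimum is attained and $$R^\star_{\mathsf{avg}}(M)=\sum_{n=1}^N (s_n-s_{n+1})\,(n-M)^+,\qquad x^+=\max\{x,0\}.$$ Moreover, caching the most requested files is optimal: there is a rate tuple $\mathbf R$ with $\sum_y p_Y(y)R_y=R^\star_{\mathsf{avg}}(M)$ that is a limit of rate tuples $\mathbf R'$ such that $(M,\mathbf R')$ is achievable by schemes whose cache content determines every file $n\le M$ and depends only on the files $n<M+1$. -/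

import Mathlib

namespace Caching

/-- The contents of `N` files of `F` bits each: a tuple in `[2^F]^N`.
The file number `n ∈ [N]` is the index `n - 1` of `Fin N`. -/
abbrev Library (N F : ℕ) : Type := Fin N → Fin (2 ^ F)

/-- A single-user caching scheme for `N` files of `F` bits with memory `M` and update rates
`R y`, one for each request `y` (a subset of the files). -/
structure Scheme (N F : ℕ) (M : ℝ) (R : Finset (Fin N) → ℝ) where
  /-- the cache encoder, which does not see the request -/
  cache : Library N F → Fin (2 ^ ⌊(F : ℝ) * M⌋₊)
  /-- the update encoder -/
  update : (y : Finset (Fin N)) → Library N F → Fin (2 ^ ⌊(F : ℝ) * R y⌋₊)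
  /-- the decoder, which estimates all the files of the request -/
  decode : (y : Finset (Fin N)) → Fin (2 ^ ⌊(F : ℝ) * M⌋₊) → Fin (2 ^ ⌊(F : ℝ) * R y⌋₊) →
    ({n // n ∈ y} → Fin (2 ^ F))

namespace Scheme

variable {N F : ℕ} {M : ℝ} {R : Finset (Fin N) → ℝ}

/-- The estimate of the requested files when the files are `w` and the request is `y`. -/
def estimate (S : Scheme N F M R) (y : Finset (Fin N)) (w : Library N F) :
    {n // n ∈ y} → Fin (2 ^ F) :=
  S.decode y (S.cache w) (S.update y w)

/-- The probability that some requested file is decoded wrongly when the request is `y`; the files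
are independent and uniform on `[2^F]`, so the tuple of files is uniform on `[2^F]^N`. -/
noncomputable def requestErrorProb (S : Scheme N F M R) (y : Finset (Fin N)) : ℝ :=
  ((Finset.univ.filter fun w : Library N F => ∃ n : {n // n ∈ y}, S.estimate y w n ≠ w n).card : ℝ)
    / (Fintype.card (Library N F) : ℝ)

/-- The probability of error: the maximum over all requests. -/
noncomputable def errorProb (S : Scheme N F M R) : ℝ :=
  Finset.univ.sup' Finset.univ_nonempty S.requestErrorProb

/-- The cache holds the first files: every file `n ≤ M` can be read off from the cache content, and
the cache content depends only on the files `n < M + 1` (so, besides the first `⌊M⌋` files, only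
file `⌊M⌋ + 1` may be partially cached, and only if `M` is not an integer). -/
def CachesFirstFiles (S : Scheme N F M R) : Prop :=
  (∀ w w' : Library N F, S.cache w = S.cache w' →
    ∀ n : Fin N, (n : ℝ) + 1 ≤ M → w n = w' n) ∧
  (∀ w w' : Library N F, (∀ n : Fin N, (n : ℝ) < M → w n = w' n) → S.cache w = S.cache w')

end Scheme

variable {N : ℕ}

/-- `(M, R)` is achievable: memory and rates are nonnegative, and for every `ε > 0` there are
schemes with arbitrarily large file size whose probability of error is below `ε`. -/
def IsAchievable (M : ℝ) (R : Finset (Fin N) → ℝ) : Prop :=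
  0 ≤ M ∧ (∀ y, 0 ≤ R y) ∧
    ∀ ε : ℝ, 0 < ε → ∀ F₀ : ℕ, ∃ F : ℕ, F₀ ≤ F ∧ 0 < F ∧
      ∃ S : Scheme N F M R, S.errorProb < ε

/-- `(M, R)` is achievable by schemes that cache the first files. -/
def IsAchievableCachingFirstFiles (M : ℝ) (R : Finset (Fin N) → ℝ) : Prop :=
  0 ≤ M ∧ (∀ y, 0 ≤ R y) ∧
    ∀ ε : ℝ, 0 < ε → ∀ F₀ : ℕ, ∃ F : ℕ, F₀ ≤ F ∧ 0 < F ∧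
      ∃ S : Scheme N F M R, S.CachesFirstFiles ∧ S.errorProb < ε

variable (N) in
/-- The optimal rate region: the closure of the set of achievable tuples. -/
def rateRegion : Set (ℝ × (Finset (Fin N) → ℝ)) :=
  closure {q | IsAchievable q.1 q.2}

/-- The average update rate of the rate tuple `R` under the request distribution `p`. -/
def avgRate (p R : Finset (Fin N) → ℝ) : ℝ := ∑ y, p y * R y

/-- The average update rates of the rate tuples that the rate region allows with memory `M`. -/
def avgRates (p : Finset (Fin N) → ℝ) (M : ℝ) : Set ℝ :=
  {r | ∃ R : Finset (Fin N) → ℝ, (M, R) ∈ rateRegion N ∧ avgRate p R = r}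

/-- The optimal memory-rate tradeoff for the average case. -/
noncomputable def optimalAvgRate (p : Finset (Fin N) → ℝ) (M : ℝ) : ℝ := sInf (avgRates p M)

/-- The probability that file `n` is requested. -/
def requestProb (p : Finset (Fin N) → ℝ) (n : Fin N) : ℝ :=
  ∑ y ∈ Finset.univ.filter (fun y : Finset (Fin N) => n ∈ y), p y

/-- The probability that the file after `n` is requested, and `0` if `n` is the last file. -/
def nextRequestProb (p : Finset (Fin N) → ℝ) (n : Fin N) : ℝ :=
  if h : (n : ℕ) + 1 < N then requestProb p ⟨(n : ℕ) + 1, h⟩ else 0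

end Caching

/-! Converse: no Fano-type inequality is needed. Small error probability makes at least half of all
libraries correct for every request at once. By pigeonhole, some cache content leaves a set `G` of
at least `2 ^ (N F - 1 - F M)` of them. For a uniform element of `G` the update alone determines the
requested files, so their entropy `H y` is at most `F R_y` bits. The first `n` files have entropy at
least `F (n - M)^+ - 1` bits, since the others account for at most `(N - n) F`. Submodularity bounds
`H y` below by the sum over `n ∈ y` of the increments `H [n] - H [n-1]`. Averaging over `y` weights
these by `s_n`, and summation by parts turns the weights into `s_n - s_{n+1} ≥ 0`, to which the
lower bound on `H [n]` applies (`Scheme.le_avgRate`). The one-bit loss vanishes as `F → ∞`.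
Achievability: store the first `M` files and send the uncached part of each requested file. The same
summation by parts, with `(n - M)^+` for `H [n]`, gives the same value. -/

namespace Caching

open Finset

/-! ### Entropy of coordinates of a uniform element of a finite set -/

section Entropy

variable {ι α : Type*} [DecidableEq α]

/-- The number of tuples in `G` that agree with `w` on the coordinates in `s`. -/
def agreeCard (G : Finset (ι → α)) (s : Finset ι) (w : ι → α) : ℕ :=
  #{v ∈ G | ∀ i ∈ s, v i = w i}

/-- The Shannon entropy (in nats) of the coordinates in `s` of a uniform element of `G`. -/
noncomputable def coordEntropy (G : Finset (ι → α)) (s : Finset ι) : ℝ :=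
  (∑ w ∈ G, (Real.log (#G) - Real.log (agreeCard G s w))) / #G

variable {G : Finset (ι → α)}

lemma agreeCard_pos {s : Finset ι} {w : ι → α} (hw : w ∈ G) : 0 < agreeCard G s w :=
  card_pos.2 ⟨w, by simp [hw]⟩

lemma agreeCard_congr {s : Finset ι} {v w : ι → α} (h : ∀ i ∈ s, v i = w i) :
    agreeCard G s v = agreeCard G s w := by
  unfold agreeCard
  congr 1
  refine filter_congr fun u _ => forall₂_congr fun i hi => ?_
  rw [h i hi]

lemma coordEntropy_empty : coordEntropy G ∅ = 0 := by
  simp [coordEntropy, agreeCard]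

lemma coordEntropy_univ [Fintype ι] (hG : G.Nonempty) :
    coordEntropy G univ = Real.log (#G) := by
  have h : ∀ w ∈ G, agreeCard G univ w = 1 := by
    intro w hw
    rw [agreeCard, card_eq_one]
    refine ⟨w, ?_⟩
    ext v
    simp only [mem_filter, mem_univ, true_imp_iff, mem_singleton]
    exact ⟨fun h => funext h.2, by rintro rfl; exact ⟨hw, fun _ => rfl⟩⟩
  have hc : (#G : ℝ) ≠ 0 := by exact_mod_cast hG.card_pos.ne'
  rw [coordEntropy, sum_congr rfl fun w hw => by rw [h w hw]]
  simp [hc]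

lemma coordEntropy_nonneg (s : Finset ι) : 0 ≤ coordEntropy G s := by
  refine div_nonneg (sum_nonneg fun w hw => sub_nonneg.2 ?_) (Nat.cast_nonneg _)
  exact Real.log_le_log (by exact_mod_cast agreeCard_pos hw)
    (by exact_mod_cast card_le_card (filter_subset _ _))

/-- The entropy of coordinates that are a function of a variable with values in `κ` is at most the
logarithm of the cardinality of `κ`. -/
lemma coordEntropy_le_log_card {κ : Type*} [Fintype κ] [DecidableEq κ] (hG : G.Nonempty)
    {s : Finset ι} (X : (ι → α) → κ)
    (hX : ∀ v ∈ G, ∀ w ∈ G, X v = X w → ∀ i ∈ s, v i = w i) :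
    coordEntropy G s ≤ Real.log (Fintype.card κ) := by
  have hc : (0 : ℝ) < #G := by exact_mod_cast hG.card_pos
  have hK : (0 : ℝ) < Fintype.card κ := by
    obtain ⟨w, _⟩ := hG
    exact_mod_cast Fintype.card_pos_iff.2 ⟨X w⟩
  -- A fibre of `X` lies in a single agreement class on `s`, so it contributes at most 1.
  have hsum : ∑ w ∈ G, (1 : ℝ) / agreeCard G s w ≤ Fintype.card κ := by
    rw [← sum_fiberwise G X]
    calc ∑ k, ∑ w ∈ G with X w = k, (1 : ℝ) / agreeCard G s w ≤ ∑ _k : κ, (1 : ℝ) := by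
          refine sum_le_sum fun k _ => ?_
          calc ∑ w ∈ G with X w = k, (1 : ℝ) / agreeCard G s w
              ≤ ∑ w ∈ G with X w = k, (1 : ℝ) / (#{w ∈ G | X w = k} : ℝ) := by
                refine sum_le_sum fun w hw => ?_
                refine one_div_le_one_div_of_le ?_ ?_
                · exact_mod_cast card_pos.2 ⟨w, hw⟩
                · rw [mem_filter] at hw
                  refine Nat.cast_le.2 (card_le_card fun v hv => ?_)
                  rw [mem_filter] at hv ⊢
                  exact ⟨hv.1, hX v hv.1 w hw.1 (hv.2.trans hw.2.symm)⟩
            _ ≤ 1 := by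
                rw [sum_const, nsmul_eq_mul, mul_one_div]
                exact div_self_le_one _
      _ = Fintype.card κ := by simp
  rw [coordEntropy, div_le_iff₀ hc]
  calc ∑ w ∈ G, (Real.log (#G) - Real.log (agreeCard G s w))
      ≤ ∑ w ∈ G, (Real.log (Fintype.card κ)
          + (#G / Fintype.card κ * (1 / agreeCard G s w) - 1)) := by
        refine sum_le_sum fun w hw => ?_
        have ha : (0 : ℝ) < agreeCard G s w := by exact_mod_cast agreeCard_pos hw
        have := Real.log_le_sub_one_of_pos
          (show (0 : ℝ) < #G / Fintype.card κ * (1 / agreeCard G s w) by positivity)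
        rw [Real.log_mul (by positivity) (by positivity), Real.log_div hc.ne' hK.ne',
          one_div, Real.log_inv] at this
        rw [one_div]
        linarith
    _ = #G * Real.log (Fintype.card κ)
          + (#G / Fintype.card κ * ∑ w ∈ G, (1 : ℝ) / agreeCard G s w - #G) := by
        rw [sum_add_distrib, sum_sub_distrib, ← mul_sum]
        simp
    _ ≤ Real.log (Fintype.card κ) * #G := by
        have : #G / Fintype.card κ * ∑ w ∈ G, (1 : ℝ) / agreeCard G s w
            ≤ #G / Fintype.card κ * (Fintype.card κ : ℝ) :=
          mul_le_mul_of_nonneg_left hsum (by positivity)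
        rw [div_mul_cancel₀ _ hK.ne'] at this
        linarith

variable [DecidableEq ι]

/-- The numerator counts pairs `(u, v)` agreeing with `w` on `s` and on `t` respectively. For fixed
`(u, v)` the possible `w` agree with one another on `s ∪ t`, which cancels that factor. Moreover `v`
agrees with `u` on `s ∩ t`, which cancels the other, leaving at most 1 for each `u`. With `log x ≤ x
- 1` this yields submodularity. -/
lemma sum_agreeCard_mul_div_le (s t : Finset ι) :
    ∑ w ∈ G, (agreeCard G s w * agreeCard G t w : ℝ)
      / (agreeCard G (s ∪ t) w * agreeCard G (s ∩ t) w) ≤ #G := by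
  have expand : ∀ w, (agreeCard G s w * agreeCard G t w : ℝ)
      / (agreeCard G (s ∪ t) w * agreeCard G (s ∩ t) w)
      = ∑ u ∈ G, ∑ v ∈ G, if (∀ i ∈ s, u i = w i) ∧ (∀ i ∈ t, v i = w i) then
          (1 : ℝ) / (agreeCard G (s ∪ t) w * agreeCard G (s ∩ t) w) else 0 := by
    intro w
    generalize (agreeCard G (s ∪ t) w * agreeCard G (s ∩ t) w : ℝ) = c
    rw [agreeCard, agreeCard, natCast_card_filter, natCast_card_filter, sum_mul_sum, sum_div]
    refine sum_congr rfl fun u _ => ?_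
    rw [sum_div]
    refine sum_congr rfl fun v _ => ?_
    simp only [ite_and]
    split_ifs <;> simp
  simp_rw [expand]
  rw [sum_comm]
  calc ∑ u ∈ G, ∑ w ∈ G, ∑ v ∈ G, (if (∀ i ∈ s, u i = w i) ∧ (∀ i ∈ t, v i = w i) then
          (1 : ℝ) / (agreeCard G (s ∪ t) w * agreeCard G (s ∩ t) w) else 0)
      ≤ ∑ u ∈ G, ∑ v ∈ G with ∀ i ∈ s ∩ t, v i = u i, (1 : ℝ) / agreeCard G (s ∩ t) u := by
        refine sum_le_sum fun u _ => ?_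
        rw [sum_comm, sum_filter]
        refine sum_le_sum fun v _ => ?_
        rw [← sum_filter]
        by_cases hne : ∃ w₀ ∈ G, (∀ i ∈ s, u i = w₀ i) ∧ ∀ i ∈ t, v i = w₀ i
        swap
        · rw [filter_eq_empty_iff.2 fun w hw h => hne ⟨w, hw, h⟩, sum_empty]
          split_ifs <;> positivity
        obtain ⟨w₀, _, hs, ht⟩ := hne
        rw [if_pos fun i hi => by
          rw [mem_inter] at hi
          rw [hs i hi.1, ht i hi.2]]
        set A := G.filter fun w => (∀ i ∈ s, u i = w i) ∧ ∀ i ∈ t, v i = w i with hA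
        have key : ∀ w ∈ A, (1 : ℝ) / (agreeCard G (s ∪ t) w * agreeCard G (s ∩ t) w)
            ≤ 1 / (#A : ℝ) * (1 / agreeCard G (s ∩ t) u) := by
          intro w hw
          have hw' := (mem_filter.1 hw).2
          rw [← agreeCard_congr (v := u) (w := w) (s := s ∩ t)
            fun i hi => hw'.1 i (mem_inter.1 hi).1, ← one_div_mul_one_div]
          refine mul_le_mul_of_nonneg_right (one_div_le_one_div_of_le ?_ ?_) (by positivity)
          · exact_mod_cast card_pos.2 ⟨w, hw⟩
          · refine Nat.cast_le.2 (card_le_card fun x hx => ?_)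
            rw [hA, mem_filter] at hx
            refine mem_filter.2 ⟨hx.1, fun i hi => ?_⟩
            rcases mem_union.1 hi with h | h
            · rw [← hx.2.1 i h, hw'.1 i h]
            · rw [← hx.2.2 i h, hw'.2 i h]
        refine (sum_le_sum key).trans ?_
        rw [sum_const, nsmul_eq_mul, ← mul_assoc, mul_one_div (#A : ℝ) (#A : ℝ)]
        exact mul_le_of_le_one_left (one_div_nonneg.2 (Nat.cast_nonneg _)) (div_self_le_one _)
    _ ≤ ∑ _u ∈ G, (1 : ℝ) := by
        refine sum_le_sum fun u _ => ?_
        rw [sum_const, nsmul_eq_mul, mul_one_div]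
        exact div_self_le_one _
    _ = #G := by simp

/-- Entropy is submodular. -/
lemma coordEntropy_union_add_inter_le (s t : Finset ι) :
    coordEntropy G (s ∪ t) + coordEntropy G (s ∩ t) ≤ coordEntropy G s + coordEntropy G t := by
  simp only [coordEntropy, ← add_div, ← sum_add_distrib]
  refine div_le_div_of_nonneg_right ?_ (Nat.cast_nonneg _)
  have hle : ∑ w ∈ G, (Real.log (agreeCard G s w) + Real.log (agreeCard G t w)
      - Real.log (agreeCard G (s ∪ t) w) - Real.log (agreeCard G (s ∩ t) w)) ≤ 0 := by
    calc _ ≤ ∑ w ∈ G, ((agreeCard G s w * agreeCard G t w : ℝ)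
            / (agreeCard G (s ∪ t) w * agreeCard G (s ∩ t) w) - 1) := by
          refine sum_le_sum fun w hw => ?_
          have h (r : Finset ι) : (0 : ℝ) < agreeCard G r w := by exact_mod_cast agreeCard_pos hw
          have h1 := h s
          have h2 := h t
          have h3 := h (s ∪ t)
          have h4 := h (s ∩ t)
          have := Real.log_le_sub_one_of_pos
            (show (0 : ℝ) < (agreeCard G s w * agreeCard G t w : ℝ)
              / (agreeCard G (s ∪ t) w * agreeCard G (s ∩ t) w) by positivity)
          rw [Real.log_div (by positivity) (by positivity), Real.log_mul h1.ne' h2.ne',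
            Real.log_mul h3.ne' h4.ne'] at this
          linarith
      _ ≤ 0 := by
          rw [sum_sub_distrib]
          have := sum_agreeCard_mul_div_le (G := G) s t
          simpa using this
  rw [← sub_nonpos, ← sum_sub_distrib]
  exact (sum_congr rfl fun w _ => by ring).trans_le hle

lemma coordEntropy_union_le [Fintype α] (hG : G.Nonempty) (s t : Finset ι) :
    coordEntropy G (s ∪ t) ≤ coordEntropy G s + #t * Real.log (Fintype.card α) := by
  induction t using Finset.induction_on with
  | empty => simp
  | insert a t ha ih =>
    have h1 := coordEntropy_union_add_inter_le (G := G) {a} (s ∪ t)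
    have h2 := coordEntropy_nonneg (G := G) ({a} ∩ (s ∪ t))
    have h3 : coordEntropy G {a} ≤ Real.log (Fintype.card α) :=
      coordEntropy_le_log_card hG (fun w => w a) fun v _ w _ h i hi => by
        rw [mem_singleton.1 hi]; exact h
    have h4 : s ∪ insert a t = {a} ∪ (s ∪ t) := by ext; simp
    rw [h4, card_insert_of_notMem ha]
    push_cast
    linarith

end Entropy

/-! ### Chain rule and summation by parts -/

/-- The first `n` files. -/
def firstFiles (N n : ℕ) : Finset (Fin N) := {i | (i : ℕ) < n}

/-- The chain rule together with the fact that conditioning reduces increments, for a submodular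
set function. -/
lemma sum_increments_le_of_submodular {N : ℕ} {h : Finset (Fin N) → ℝ} (h0 : h ∅ = 0)
    (hsub : ∀ s t, h (s ∪ t) + h (s ∩ t) ≤ h s + h t) (y : Finset (Fin N)) :
    ∑ n ∈ y, (h (firstFiles N (n + 1)) - h (firstFiles N n)) ≤ h y := by
  induction y using Finset.induction_on_max with
  | empty => simp [h0]
  | insert a s hs ih =>
    have ha : a ∉ s := fun h => lt_irrefl _ (hs a h)
    rw [sum_insert ha]
    -- As `a` exceeds all of `s`, submodularity for this pair bounds the increment at `a` by `h
    -- (insert a s) - h s`.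
    have h1 : insert a s ∪ firstFiles N a = firstFiles N (a + 1) := by
      ext i
      simp only [firstFiles, mem_union, mem_insert, mem_filter, mem_univ, true_and, Fin.ext_iff]
      refine ⟨?_, fun h => ?_⟩
      · rintro ((h | h) | h)
        · omega
        · exact Nat.lt_succ_of_lt (hs i h)
        · omega
      · omega
    have h2 : insert a s ∩ firstFiles N a = s := by
      ext i
      simp only [firstFiles, mem_inter, mem_insert, mem_filter, mem_univ, true_and, Fin.ext_iff]
      refine ⟨?_, fun h => ⟨Or.inr h, hs i h⟩⟩
      rintro ⟨h | h, h'⟩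
      · omega
      · exact h
    have := hsub (insert a s) (firstFiles N a)
    rw [h1, h2] at this
    linarith

lemma sum_range_mul_increments (S H : ℕ → ℝ) (h0 : H 0 = 0) (k : ℕ) :
    ∑ n ∈ range k, S n * (H (n + 1) - H n)
      = ∑ n ∈ range k, (S n - S (n + 1)) * H (n + 1) + S k * H k := by
  induction k with
  | zero => simp [h0]
  | succ k ih => rw [sum_range_succ, sum_range_succ, ih]; ring

section RequestProb

variable {N : ℕ} (p : Finset (Fin N) → ℝ)

lemma sum_requestProb_mul_increments (H : ℕ → ℝ) (h0 : H 0 = 0) :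
    ∑ n : Fin N, requestProb p n * (H (n + 1) - H n)
      = ∑ n : Fin N, (requestProb p n - nextRequestProb p n) * H (n + 1) := by
  -- Extension by zero makes the boundary term `S N * H N` vanish.
  let S : ℕ → ℝ := fun n => if h : n < N then requestProb p ⟨n, h⟩ else 0
  have h1 := sum_range_mul_increments S H h0 N
  rw [show S N = 0 by simp [S], zero_mul, add_zero,
    ← Fin.sum_univ_eq_sum_range (fun n => S n * (H (n + 1) - H n)),
    ← Fin.sum_univ_eq_sum_range (fun n => (S n - S (n + 1)) * H (n + 1))] at h1
  simpa [S, nextRequestProb] using h1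

lemma avgRate_sum (g : Fin N → ℝ) :
    avgRate p (fun y => ∑ n ∈ y, g n) = ∑ n, requestProb p n * g n := by
  simp only [avgRate, requestProb, sum_mul, mul_sum]
  simp_rw [sum_filter]
  rw [sum_comm]
  refine sum_congr rfl fun y _ => ?_
  rw [← sum_filter]
  simp

variable {p}

lemma nextRequestProb_le (hp : ∀ y, 0 ≤ p y) (hs : Antitone (requestProb p)) (n : Fin N) :
    nextRequestProb p n ≤ requestProb p n := by
  unfold nextRequestProb
  split_ifs with h
  · exact hs (Fin.le_def.2 (Nat.le_succ _))
  · exact sum_nonneg fun y _ => hp y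

end RequestProb

/-! ### Converse: lower bound on the average rate -/

section Converse

variable {N F : ℕ} {M : ℝ} {R : Finset (Fin N) → ℝ}

/-- If every request fails with probability below `2⁻⁽ᴺ⁺¹⁾`, then at least half of the libraries are
decoded correctly under every request. -/
lemma Scheme.card_le_two_mul_card_correct (S : Scheme N F M R)
    (hS : S.errorProb < 1 / 2 ^ (N + 1)) :
    Fintype.card (Library N F) ≤
      2 * #{w : Library N F | ∀ y, ∀ n : {n // n ∈ y}, S.estimate y w n = w n} := by
  classical
  set L := Fintype.card (Library N F) with hL
  have hLpos : (0 : ℝ) < L := by exact_mod_cast Fintype.card_pos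
  let B : Finset (Fin N) → Finset (Library N F) := fun y =>
    {w | ∃ n : {n // n ∈ y}, S.estimate y w n ≠ w n}
  have hB : ∀ y, (#(B y) : ℝ) ≤ L / 2 ^ (N + 1) := by
    intro y
    have : S.requestErrorProb y < 1 / 2 ^ (N + 1) :=
      (le_sup' S.requestErrorProb (mem_univ y)).trans_lt hS
    rw [Scheme.requestErrorProb, div_lt_iff₀ hLpos] at this
    calc (#(B y) : ℝ) ≤ 1 / 2 ^ (N + 1) * L := by
          convert this.le
      _ = _ := by ring
  have hcompl : (univ.biUnion B)ᶜ ⊆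
      ({w : Library N F | ∀ y, ∀ n : {n // n ∈ y}, S.estimate y w n = w n} :
        Finset (Library N F)) := by
    intro w hw
    simpa [B] using hw
  -- Union bound over the `2 ^ N` requests.
  have hU : (#(univ.biUnion B) : ℝ) ≤ L / 2 := by
    calc (#(univ.biUnion B) : ℝ) ≤ ∑ y, (#(B y) : ℝ) := by exact_mod_cast card_biUnion_le
      _ ≤ ∑ _y : Finset (Fin N), (L : ℝ) / 2 ^ (N + 1) := sum_le_sum fun y _ => hB y
      _ = L / 2 := by
        rw [sum_const, card_univ, Fintype.card_finset, Fintype.card_fin, nsmul_eq_mul]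
        push_cast
        rw [pow_succ]
        field_simp
  have h1 := card_le_card hcompl
  have h2 := card_add_card_compl (univ.biUnion B)
  have h3 : 2 * #(univ.biUnion B) ≤ L := by
    have : (2 : ℝ) * #(univ.biUnion B) ≤ L := by linarith
    exact_mod_cast this
  omega

lemma Scheme.le_avgRate (S : Scheme N F M R) (hS : S.errorProb < 1 / 2 ^ (N + 1)) (hF : 0 < F)
    (hM : 0 ≤ M) (hR : ∀ y, 0 ≤ R y) {p : Finset (Fin N) → ℝ} (hp : ∀ y, 0 ≤ p y)
    (hs : Antitone (requestProb p)) :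
    ∑ n : Fin N, (requestProb p n - nextRequestProb p n) * max ((n : ℝ) + 1 - M) 0
      ≤ avgRate p R + (∑ n : Fin N, (requestProb p n - nextRequestProb p n)) / F := by
  classical
  set A : Finset (Library N F) := {w | ∀ y, ∀ n : {n // n ∈ y}, S.estimate y w n = w n} with hA
  have hAcard := S.card_le_two_mul_card_correct hS
  rw [← hA] at hAcard
  -- Fixing one popular cache content takes the place of conditioning on the cache.
  obtain ⟨z, -, hz⟩ : ∃ z ∈ (univ : Finset (Fin (2 ^ ⌊(F : ℝ) * M⌋₊))),
      #A / (2 ^ ⌊(F : ℝ) * M⌋₊ : ℝ) ≤ (#{w ∈ A | S.cache w = z} : ℝ) := by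
    by_contra! hcon
    have h1 : ∑ z : Fin (2 ^ ⌊(F : ℝ) * M⌋₊), (#{w ∈ A | S.cache w = z} : ℝ)
        < ∑ _z : Fin (2 ^ ⌊(F : ℝ) * M⌋₊), #A / (2 ^ ⌊(F : ℝ) * M⌋₊ : ℝ) :=
      sum_lt_sum_of_nonempty univ_nonempty hcon
    have h2 : #A = ∑ z : Fin (2 ^ ⌊(F : ℝ) * M⌋₊), #{w ∈ A | S.cache w = z} :=
      card_eq_sum_card_fiberwise fun _ _ => mem_univ _
    rw [← Nat.cast_sum, ← h2, sum_const, card_univ, Fintype.card_fin, nsmul_eq_mul] at h1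
    push_cast at h1
    rw [mul_div_cancel₀ _ (by positivity)] at h1
    exact lt_irrefl _ h1
  set G : Finset (Library N F) := {w ∈ A | S.cache w = z} with hG
  have hlib : Fintype.card (Library N F) = 2 ^ (N * F) := by
    simp [Library, ← pow_mul, mul_comm]
  have hApos : (0 : ℝ) < #A := by
    have : 0 < Fintype.card (Library N F) := Fintype.card_pos
    exact_mod_cast (by omega : 0 < #A)
  have hGpos : (0 : ℝ) < #G := lt_of_lt_of_le (by positivity) hz
  have hGne : G.Nonempty := card_pos.1 (by exact_mod_cast hGpos)
  have hlog2 : (0 : ℝ) < Real.log 2 := Real.log_pos one_lt_two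
  have hFpos : (0 : ℝ) < F := by exact_mod_cast hF
  have hlogG : (N * F - 1 - F * M) * Real.log 2 ≤ Real.log (#G) := by
    have h1 := Real.log_le_log (by positivity) hz
    have h2 : Real.log (2 ^ (N * F) : ℝ) ≤ Real.log (2 * #A) :=
      Real.log_le_log (by positivity) (by rw [hlib] at hAcard; exact_mod_cast hAcard)
    rw [Real.log_div hApos.ne' (by positivity), Real.log_pow] at h1
    rw [Real.log_mul two_ne_zero hApos.ne', Real.log_pow] at h2
    push_cast at h2
    have h3 : (⌊(F : ℝ) * M⌋₊ : ℝ) * Real.log 2 ≤ F * M * Real.log 2 :=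
      mul_le_mul_of_nonneg_right (Nat.floor_le (by positivity)) hlog2.le
    linarith
  have hupper : ∀ y, coordEntropy G y ≤ F * R y * Real.log 2 := by
    intro y
    have h1 : coordEntropy G y ≤ Real.log (Fintype.card (Fin (2 ^ ⌊(F : ℝ) * R y⌋₊))) := by
      refine coordEntropy_le_log_card hGne (S.update y) fun v hv w hw hvw i hi => ?_
      rw [hG, hA, mem_filter, mem_filter] at hv hw
      rw [← hv.1.2 y ⟨i, hi⟩, ← hw.1.2 y ⟨i, hi⟩]
      simp only [Scheme.estimate, hv.2, hw.2, hvw]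
    rw [Fintype.card_fin] at h1
    push_cast at h1
    rw [Real.log_pow] at h1
    exact h1.trans (mul_le_mul_of_nonneg_right
      (Nat.floor_le (mul_nonneg hFpos.le (hR y))) hlog2.le)
  have hlower : ∀ n : Fin N, (F * max ((n : ℝ) + 1 - M) 0 - 1) * Real.log 2
      ≤ coordEntropy G (firstFiles N (n + 1)) := by
    intro n
    rcases max_cases ((n : ℝ) + 1 - M) 0 with ⟨h, -⟩ | ⟨h, -⟩
    · have h1 := coordEntropy_union_le hGne (firstFiles N (n + 1)) (firstFiles N (n + 1))ᶜ
      have hc : (#(firstFiles N (n + 1))ᶜ : ℝ) = N - (n + 1) := by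
        have h2 : #(firstFiles N (n + 1)) = n + 1 := by
          have : firstFiles N (n + 1) = Iic n := by
            ext i
            simp only [firstFiles, mem_filter, mem_univ, true_and, mem_Iic, Fin.le_def]
            omega
          rw [this, Fin.card_Iic]
        rw [card_compl, h2, Fintype.card_fin, Nat.cast_sub n.2]
        push_cast
        ring
      rw [union_compl, coordEntropy_univ hGne, hc, Fintype.card_fin] at h1
      push_cast at h1
      rw [Real.log_pow] at h1
      rw [h]
      linarith
    · rw [h]
      have := coordEntropy_nonneg (G := G) (firstFiles N (n + 1))
      linarith
  have hchain : ∑ n : Fin N, (requestProb p n - nextRequestProb p n)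
      * coordEntropy G (firstFiles N (n + 1)) ≤ F * Real.log 2 * avgRate p R := by
    rw [← sum_requestProb_mul_increments p (fun n => coordEntropy G (firstFiles N n))
      (by simp [firstFiles, coordEntropy_empty]),
      ← avgRate_sum p fun n => coordEntropy G (firstFiles N (n + 1))
        - coordEntropy G (firstFiles N n), avgRate, avgRate, mul_sum]
    refine sum_le_sum fun y _ => ?_
    have h1 := (sum_increments_le_of_submodular coordEntropy_empty
      coordEntropy_union_add_inter_le y).trans (hupper y)
    have h2 := mul_le_mul_of_nonneg_left h1 (hp y)
    linarith
  have hsum : ∑ n : Fin N, (requestProb p n - nextRequestProb p n)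
      * ((F * max ((n : ℝ) + 1 - M) 0 - 1) * Real.log 2) ≤ F * Real.log 2 * avgRate p R :=
    (sum_le_sum fun n _ => mul_le_mul_of_nonneg_left (hlower n)
      (sub_nonneg.2 (nextRequestProb_le hp hs n))).trans hchain
  have hid : ∑ n : Fin N, (requestProb p n - nextRequestProb p n)
      * ((F * max ((n : ℝ) + 1 - M) 0 - 1) * Real.log 2)
      = F * Real.log 2 * (∑ n : Fin N, (requestProb p n - nextRequestProb p n)
          * max ((n : ℝ) + 1 - M) 0
        - (∑ n : Fin N, (requestProb p n - nextRequestProb p n)) / F) := by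
    rw [sum_div, ← sum_sub_distrib, mul_sum]
    refine sum_congr rfl fun n _ => ?_
    field_simp
  rw [hid] at hsum
  have := le_of_mul_le_mul_left hsum (by positivity)
  linarith

lemma IsAchievable.le_avgRate (h : IsAchievable M R) {p : Finset (Fin N) → ℝ}
    (hp : ∀ y, 0 ≤ p y) (hs : Antitone (requestProb p)) :
    ∑ n : Fin N, (requestProb p n - nextRequestProb p n) * max ((n : ℝ) + 1 - M) 0
      ≤ avgRate p R := by
  obtain ⟨hM, hR, hsch⟩ := h
  set C := ∑ n : Fin N, (requestProb p n - nextRequestProb p n) with hC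
  have hC0 : 0 ≤ C := sum_nonneg fun n _ => sub_nonneg.2 (nextRequestProb_le hp hs n)
  refine le_of_forall_pos_le_add fun η hη => ?_
  -- The file size is taken large enough that the loss `C / F` is at most `η`.
  obtain ⟨F, hF₀, hF, S, hS⟩ := hsch (1 / 2 ^ (N + 1)) (by positivity) ⌈C / η⌉₊
  refine (S.le_avgRate hS hF hM hR hp hs).trans ?_
  have h1 : C / η ≤ F := (Nat.le_ceil _).trans (by exact_mod_cast hF₀)
  have hFpos : (0 : ℝ) < F := by exact_mod_cast hF
  have : C / F ≤ η := by
    rw [div_le_iff₀ hη] at h1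
    rw [div_le_iff₀ hFpos]
    linarith
  rw [← hC]
  linarith

lemma le_avgRate_of_mem_rateRegion (h : (M, R) ∈ rateRegion N) {p : Finset (Fin N) → ℝ}
    (hp : ∀ y, 0 ≤ p y) (hs : Antitone (requestProb p)) :
    ∑ n : Fin N, (requestProb p n - nextRequestProb p n) * max ((n : ℝ) + 1 - M) 0
      ≤ avgRate p R := by
  have hclosed : IsClosed {q : ℝ × (Finset (Fin N) → ℝ) |
      ∑ n : Fin N, (requestProb p n - nextRequestProb p n) * max ((n : ℝ) + 1 - q.1) 0
        ≤ avgRate p q.2} := by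
    unfold avgRate
    exact isClosed_le (by fun_prop) (by fun_prop)
  exact closure_minimal (fun q hq => IsAchievable.le_avgRate hq hp hs) hclosed h

end Converse

/-! ### Achievability: uncoded caching of the first files -/

section Achievability

variable {N F : ℕ} {M : ℝ} {R : Finset (Fin N) → ℝ}

/-- Encoders that jointly determine the requested files extend to a scheme without errors. -/
lemma exists_scheme_errorProb_eq_zero (cache : Library N F → Fin (2 ^ ⌊(F : ℝ) * M⌋₊))
    (update : (y : Finset (Fin N)) → Library N F → Fin (2 ^ ⌊(F : ℝ) * R y⌋₊))
    (h : ∀ y w w', cache w = cache w' → update y w = update y w' → ∀ n ∈ y, w n = w' n) :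
    ∃ S : Scheme N F M R, S.cache = cache ∧ S.errorProb = 0 := by
  classical
  -- Any library consistent with cache and update will do; the default 0 occurs only for pairs that
  -- no library produces.
  let dec : (y : Finset (Fin N)) → Fin (2 ^ ⌊(F : ℝ) * M⌋₊) → Fin (2 ^ ⌊(F : ℝ) * R y⌋₊) →
      ({n // n ∈ y} → Fin (2 ^ F)) := fun y z x n =>
    if hw : ∃ w, cache w = z ∧ update y w = x then hw.choose n else 0
  refine ⟨⟨cache, update, dec⟩, rfl, ?_⟩
  have hreq : ∀ y, Scheme.requestErrorProb ⟨cache, update, dec⟩ y = 0 := by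
    intro y
    rw [Scheme.requestErrorProb, filter_eq_empty_iff.2, card_empty, Nat.cast_zero, zero_div]
    rintro w - ⟨n, hn⟩
    refine hn ?_
    have hw : ∃ w', cache w' = cache w ∧ update y w' = update y w := ⟨w, rfl, rfl⟩
    simp only [Scheme.estimate, dec, dif_pos hw]
    exact h y _ _ hw.choose_spec.1 hw.choose_spec.2 n n.2
  refine le_antisymm (sup'_le _ _ fun y _ => (hreq y).le) ?_
  exact (hreq ∅).symm.le.trans (le_sup' _ (mem_univ _))

/-- Cache `a n` bits of each file `n`, and send the remaining bits of the requested files. -/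
lemma exists_scheme_of_split (a : Fin N → ℕ) (ha : ∀ n, a n ≤ F)
    (hM : ∑ n, a n ≤ ⌊(F : ℝ) * M⌋₊) (hR : ∀ y, ∑ n ∈ y, (F - a n) ≤ ⌊(F : ℝ) * R y⌋₊) :
    ∃ S : Scheme N F M R, S.errorProb = 0 ∧
      (∀ w w', S.cache w = S.cache w' → ∀ n, a n = F → w n = w' n) ∧
      ∀ w w', (∀ n, a n ≠ 0 → w n = w' n) → S.cache w = S.cache w' := by
  classical
  have hsplit : ∀ n, Nonempty (Fin (2 ^ F) ≃ Fin (2 ^ a n) × Fin (2 ^ (F - a n))) := fun n =>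
    Fintype.card_eq.1 (by
      simp only [Fintype.card_prod, Fintype.card_fin, ← pow_add, Nat.add_sub_cancel' (ha n)])
  let e := fun n => (hsplit n).some
  have hcache : Nonempty ((∀ n, Fin (2 ^ a n)) ↪ Fin (2 ^ ⌊(F : ℝ) * M⌋₊)) :=
    Function.Embedding.nonempty_of_card_le (by
      simp only [Fintype.card_pi, Fintype.card_fin, prod_pow_eq_pow_sum]
      exact Nat.pow_le_pow_right two_pos hM)
  have hupdate : ∀ y : Finset (Fin N),
      Nonempty ((∀ n : {n // n ∈ y}, Fin (2 ^ (F - a n))) ↪ Fin (2 ^ ⌊(F : ℝ) * R y⌋₊)) :=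
    fun y => Function.Embedding.nonempty_of_card_le (by
      simp only [Fintype.card_pi, Fintype.card_fin, prod_pow_eq_pow_sum]
      rw [sum_coe_sort y fun n => F - a n]
      exact Nat.pow_le_pow_right two_pos (hR y))
  let c := hcache.some
  let u := fun y => (hupdate y).some
  obtain ⟨S, hS, herr⟩ := exists_scheme_errorProb_eq_zero (R := R)
    (fun w : Library N F => c fun n => (e n (w n)).1)
    (fun y w => u y fun n => (e n (w n)).2) (by
      intro y w w' h1 h2 n hn
      exact (e n).injective (Prod.ext (congrFun (c.injective h1) n)
        (congrFun ((u y).injective h2) ⟨n, hn⟩)))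
  refine ⟨S, herr, fun w w' h n hn => ?_, fun w w' h => ?_⟩
  · rw [hS] at h
    refine (e n).injective (Prod.ext (congrFun (c.injective h) n) ?_)
    have : Subsingleton (Fin (2 ^ (F - a n))) := by
      rw [hn, Nat.sub_self, pow_zero]; infer_instance
    exact Subsingleton.elim _ _
  · rw [hS]
    refine congrArg c (funext fun n => ?_)
    by_cases hn : a n = 0
    · have : Subsingleton (Fin (2 ^ a n)) := by
        rw [hn, pow_zero]; infer_instance
      exact Subsingleton.elim _ _
    · rw [h n hn]

/-- The fraction of file `n` that has to be sent when a cache of size `M` holds the first files. -/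
noncomputable def uncachedFraction (M : ℝ) (n : ℕ) : ℝ :=
  max (((n + 1 : ℕ) : ℝ) - M) 0 - max ((n : ℝ) - M) 0

lemma uncachedFraction_nonneg (M : ℝ) (n : ℕ) : 0 ≤ uncachedFraction M n := by
  unfold uncachedFraction
  push_cast
  exact sub_nonneg.2 (max_le_max (by linarith) le_rfl)

lemma uncachedFraction_le_one (M : ℝ) (n : ℕ) : uncachedFraction M n ≤ 1 := by
  unfold uncachedFraction
  push_cast
  have h1 := le_max_left ((n : ℝ) - M) 0
  have h2 := le_max_right ((n : ℝ) - M) 0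
  rw [sub_le_iff_le_add]
  exact max_le (by linarith) (by linarith)

/-- The uncached fractions telescope to `(N - M)^+`, so the cached ones sum to `min N M`. -/
lemma sum_one_sub_uncachedFraction_le (hM : 0 ≤ M) (N : ℕ) :
    ∑ n : Fin N, (1 - uncachedFraction M n) ≤ M := by
  rw [Fin.sum_univ_eq_sum_range (fun n => 1 - uncachedFraction M n), sum_sub_distrib]
  unfold uncachedFraction
  rw [sum_range_sub (fun n : ℕ => max ((n : ℝ) - M) 0)]
  have h1 : max (((0 : ℕ) : ℝ) - M) 0 = 0 := max_eq_right (by simpa using hM)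
  have h2 := le_max_left ((N : ℝ) - M) 0
  rw [h1]
  simp only [sum_const, card_range, nsmul_eq_mul, mul_one]
  linarith

/-- Rounding costs less than one bit per requested file, at most `N` bits in all; the slack `δ`
covers this once `F * δ ≥ N`. -/
lemma isAchievableCachingFirstFiles_add (hM : 0 ≤ M) {δ : ℝ} (hδ : 0 < δ) :
    IsAchievableCachingFirstFiles M
      fun y : Finset (Fin N) => ∑ n ∈ y, uncachedFraction M n + δ := by
  refine ⟨hM, fun y => add_nonneg (sum_nonneg fun n _ => uncachedFraction_nonneg M n) hδ.le,
    fun ε hε F₀ => ?_⟩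
  let F := max (F₀ + 1) ⌈N / δ⌉₊
  have hF : 0 < F := lt_max_of_lt_left (Nat.succ_pos _)
  have hFδ : (N : ℝ) ≤ F * δ := by
    rw [← div_le_iff₀ hδ]
    exact (Nat.le_ceil _).trans (by exact_mod_cast le_max_right _ _)
  have hFpos : (0 : ℝ) < F := by exact_mod_cast hF
  let a : Fin N → ℕ := fun n => ⌊(F : ℝ) * (1 - uncachedFraction M n)⌋₊
  have hnn : ∀ n : Fin N, 0 ≤ (F : ℝ) * (1 - uncachedFraction M n) := fun n =>
    mul_nonneg hFpos.le (sub_nonneg.2 (uncachedFraction_le_one M n))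
  have ha : ∀ n, a n ≤ F := fun n => by
    refine Nat.floor_le_of_le (mul_le_of_le_one_right hFpos.le ?_)
    linarith [uncachedFraction_nonneg M n]
  obtain ⟨S, herr, h1, h2⟩ := exists_scheme_of_split (M := M)
    (R := fun y => ∑ n ∈ y, uncachedFraction M n + δ) a ha
    (by
      refine Nat.le_floor ?_
      push_cast
      calc ∑ n, (a n : ℝ) ≤ ∑ n : Fin N, (F : ℝ) * (1 - uncachedFraction M n) :=
            sum_le_sum fun n _ => Nat.floor_le (hnn n)
        _ ≤ F * M := by
            rw [← mul_sum]
            exact mul_le_mul_of_nonneg_left (sum_one_sub_uncachedFraction_le hM N) hFpos.le)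
    (by
      intro y
      refine Nat.le_floor ?_
      push_cast
      calc ∑ n ∈ y, ((F - a n : ℕ) : ℝ) ≤ ∑ n ∈ y, ((F : ℝ) * uncachedFraction M n + 1) := by
            refine sum_le_sum fun n _ => ?_
            rw [Nat.cast_sub (ha n)]
            have : (F : ℝ) * (1 - uncachedFraction M n) < a n + 1 := Nat.lt_floor_add_one _
            linarith
        _ = F * ∑ n ∈ y, uncachedFraction M n + #y := by
            rw [sum_add_distrib, mul_sum]; simp
        _ ≤ F * (∑ n ∈ y, uncachedFraction M n + δ) := by
            have : (#y : ℝ) ≤ N := by exact_mod_cast card_finset_fin_le y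
            linarith)
  refine ⟨F, (Nat.le_succ _).trans (le_max_left _ _), hF, S, ⟨?_, ?_⟩, herr ▸ hε⟩
  · intro w w' h n hn
    refine h1 w w' h n ?_
    have : uncachedFraction M n = 0 := by
      unfold uncachedFraction
      push_cast
      rw [max_eq_right (by linarith), max_eq_right (by linarith), sub_zero]
    simp [a, this]
  · intro w w' h
    refine h2 w w' fun n hn => h n ?_
    by_contra! hle
    refine hn ?_
    have : uncachedFraction M n = 1 := by
      unfold uncachedFraction
      push_cast
      rw [max_eq_left (by linarith), max_eq_left (by linarith)]
      ring
    simp [a, this]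

lemma mem_closure_isAchievableCachingFirstFiles (hM : 0 ≤ M) :
    (fun y : Finset (Fin N) => ∑ n ∈ y, uncachedFraction M n)
      ∈ closure {R : Finset (Fin N) → ℝ | IsAchievableCachingFirstFiles M R} := by
  have hcont : Continuous fun (δ : ℝ) (y : Finset (Fin N)) =>
      ∑ n ∈ y, uncachedFraction M n + δ := by fun_prop
  have h0 : (0 : ℝ) ∈ closure (Set.Ioi 0) := by simp
  simpa using map_mem_closure hcont h0 fun δ hδ => isAchievableCachingFirstFiles_add hM hδ

lemma mem_rateRegion_of_mem_closure
    (h : R ∈ closure {R : Finset (Fin N) → ℝ | IsAchievableCachingFirstFiles M R}) :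
    (M, R) ∈ rateRegion N := by
  refine map_mem_closure (f := fun R => (M, R)) (by fun_prop) h ?_
  rintro R' ⟨h0, h1, h2⟩
  refine ⟨h0, h1, fun ε hε F₀ => ?_⟩
  obtain ⟨F, hF₀, hF, S, -, hS⟩ := h2 ε hε F₀
  exact ⟨F, hF₀, hF, S, hS⟩

lemma avgRate_uncachedFraction (hM : 0 ≤ M) (p : Finset (Fin N) → ℝ) :
    avgRate p (fun y => ∑ n ∈ y, uncachedFraction M n)
      = ∑ n : Fin N, (requestProb p n - nextRequestProb p n) * max ((n : ℝ) + 1 - M) 0 := by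
  rw [avgRate_sum p fun n => uncachedFraction M n]
  simpa [uncachedFraction] using
    sum_requestProb_mul_increments p (fun n => max ((n : ℝ) - M) 0) (by simpa using hM)

end Achievability

end Caching

theorem theorem6 (N : ℕ) (p : Finset (Fin N) → ℝ)
    (hp : p ∈ stdSimplex ℝ (Finset (Fin N)))
    (hs : Antitone (Caching.requestProb p))
    (M : ℝ) (hM : 0 ≤ M) :
    IsLeast (Caching.avgRates p M) (Caching.optimalAvgRate p M) ∧
    Caching.optimalAvgRate p M =
      ∑ n : Fin N, (Caching.requestProb p n - Caching.nextRequestProb p n) *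
        max ((n : ℝ) + 1 - M) 0 ∧
    ∃ R ∈ closure {R : Finset (Fin N) → ℝ | Caching.IsAchievableCachingFirstFiles M R},
      Caching.avgRate p R = Caching.optimalAvgRate p M := by
  have hmem := Caching.mem_closure_isAchievableCachingFirstFiles (N := N) hM
  have havg := Caching.avgRate_uncachedFraction hM p
  have hleast : IsLeast (Caching.avgRates p M)
      (∑ n : Fin N, (Caching.requestProb p n - Caching.nextRequestProb p n) *
        max ((n : ℝ) + 1 - M) 0) := by
    refine ⟨⟨_, Caching.mem_rateRegion_of_mem_closure hmem, havg⟩, ?_⟩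
    rintro r ⟨R, hR, rfl⟩
    exact Caching.le_avgRate_of_mem_rateRegion hR hp.1 hs
  have heq : Caching.optimalAvgRate p M = _ := hleast.csInf_eq
  exact ⟨heq ▸ hleast, heq, _, hmem, havg.trans heq.symm⟩
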